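/- There is an operator space structure on $B(\ell^2)$ (compatible with the operator norm) for which there exists a predual Banach space, but not a predual operator space. Explicitly, let $K(\ell^2)$ be the ideal of compact operators, let $Q = B(\ell^2)/K(\ell^2)$ be the Calkin algebra, let $Q^{\rm op}$ be its opposite $C^*$-algebra, and write $\dot x$ for the class of $x \in B(\ell^2)$ in $Q$. The map $\varphi : B(\ell^2) \to B(\ell^2) \oplus^\infty Q^{\rm op}$, $\varphi(x) = (x, \dot x)$, is a linear isometry whose range $X = \{(x,\dot x) : x \in B(\ell^2)\}$ is an operator system (a self-adjoint linear subspace of the $C^*$-algebra containing its unit). Give $B(\ell^2)$ the operator space structure of $X$, that is, $\|[x_{ij}]\|_n := \|[\varphi(x_{ij})]\|_{M_n(B(\ell^2)\oplus^\infty Q^{\rm op})}$. Then: (1) $B(\ell^2)$ is linearly isometric to the dual of a Banach space; but (2) there is no operator space $Y$ such that $B(\ell^2)$ with this operator space structure is completely isometric to the dual operator space $Y^*$, where $M_n(Y^*)$ is normed through the canonical identification $M_n(Y^*) \cong CB(Y, M_n)$. Here an operator space is a Banach space $V$ together with norms on all matrix spaces $M_n(V)$ induced by a linear isometric embedding of $V$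 in a $C^*$-algebra. -/

import Mathlib

open scoped ENNReal InnerProductSpace

universe u v

noncomputable section

/-! ### Quotients of C*-algebras by closed self-adjoint two-sided ideals -/

section QuotientCStar

variable {A : Type*} [CStarAlgebra A] (I : Ideal A)

/-- For `k` in a closed self-adjoint ideal, there is a self-adjoint `e` in the ideal with
`‖1 - e‖ ≤ 1` and `k e` close to `k`. -/
theorem exists_almost_unit [I.IsTwoSided] (hI : IsClosed (I : Set A))
    (hstar : ∀ a ∈ I, star a ∈ I) (k : A) (hk : k ∈ I) {ε : ℝ} (hε : 0 < ε) :
    ∃ e ∈ I, star e = e ∧ ‖1 - e‖ ≤ 1 ∧ ‖k - k * e‖ < ε := by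
  let J : NonUnitalStarSubalgebra ℂ A :=
    { carrier := I
      add_mem' := fun ha hb => I.add_mem ha hb
      zero_mem' := I.zero_mem
      mul_mem' := fun {a b} _ hb => I.mul_mem_left a hb
      smul_mem' := fun c a ha => by
        rw [← one_mul a, ← smul_mul_assoc]
        exact I.mul_mem_left _ ha
      star_mem' := fun {a} ha => hstar a ha }
  have : IsClosed (J : Set A) := hI
  let := CStarAlgebra.spectralOrder A
  let := CStarAlgebra.spectralOrderedRing A
  let := CStarAlgebra.spectralOrder J
  let := CStarAlgebra.spectralOrderedRing J
  have hu := CStarAlgebra.increasingApproximateUnit J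
  have h1 := (hu.tendsto_mul_left ⟨k, hk⟩).eventually (Metric.ball_mem_nhds _ hε)
  obtain ⟨e, he1, he2, he3, he4⟩ := (h1.and (hu.eventually_nonneg.and
    (hu.eventually_norm.and hu.eventually_star_eq))).exists
  have hpos : (0 : A) ≤ (e : A) := by
    obtain ⟨b, hb⟩ := CStarAlgebra.nonneg_iff_eq_star_mul_self.mp he2
    have : (e : A) = star (b : A) * (b : A) := by rw [hb]; rfl
    rw [this]
    exact star_mul_self_nonneg _
  refine ⟨e, e.2, congrArg Subtype.val he4, ?_, ?_⟩
  · have hle : (e : A) ≤ 1 := (CStarAlgebra.norm_le_one_iff_of_nonneg (e : A) hpos).mp he3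
    exact (CStarAlgebra.norm_le_one_iff_of_nonneg (1 - (e : A)) (sub_nonneg.mpr hle)).mpr
      (sub_le_self _ hpos)
  · rw [dist_comm, dist_eq_norm] at he1
    exact he1

/-- The C*-algebra structure of the quotient `A ⧸ I` by a closed, self-adjoint, two-sided
ideal: quotient algebra, quotient norm, `star (a + I) = star a + I`. -/
@[reducible]
def quotientCStarAlgebra [I.IsTwoSided] [hI : IsClosed (I : Set A)]
    (hstar : ∀ a ∈ I, star a ∈ I) : CStarAlgebra (A ⧸ I) :=
  letI sr : StarRing (A ⧸ I) :=
    { star := Quotient.map' star (fun a b h => by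
        rw [Submodule.quotientRel_def] at h ⊢
        rw [← star_sub]
        exact hstar _ h)
      star_involutive := by
        rintro ⟨a⟩
        exact congrArg (Ideal.Quotient.mk I) (star_star a)
      star_mul := by
        rintro ⟨a⟩ ⟨b⟩
        exact congrArg (Ideal.Quotient.mk I) (star_mul a b)
      star_add := by
        rintro ⟨a⟩ ⟨b⟩
        exact congrArg (Ideal.Quotient.mk I) (star_add a b) }
  letI nr : NormedRing (A ⧸ I) :=
    { Submodule.Quotient.normedAddCommGroup I, Ideal.Quotient.ring I with
      norm_mul_le := by
        intro x y
        refine le_of_forall_pos_le_add fun ε hε => ?_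
        have := ((Metric.nhds_basis_ball.prod_nhds Metric.nhds_basis_ball).tendsto_iff
          Metric.nhds_basis_ball).mp (continuous_mul.tendsto (‖x‖, ‖y‖)) ε hε
        simp only [Set.mem_prod, Metric.mem_ball, and_imp, Prod.forall, Prod.exists] at this
        rcases this with ⟨ε₁, ε₂, ⟨h₁, h₂⟩, h⟩
        obtain ⟨a, rfl, ha⟩ := Submodule.Quotient.norm_mk_lt x h₁
        obtain ⟨b, rfl, hb⟩ := Submodule.Quotient.norm_mk_lt y h₂
        have ha' := Submodule.Quotient.norm_mk_le (S := I) a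
        have hb' := Submodule.Quotient.norm_mk_le (S := I) b
        simp only [dist, abs_sub_lt_iff] at h
        specialize h ‖a‖ ‖b‖ ⟨by linarith, by linarith⟩ ⟨by linarith, by linarith⟩
        calc
          _ ≤ ‖a‖ * ‖b‖ := (Submodule.Quotient.norm_mk_le (S := I) (a * b)).trans
              (norm_mul_le a b)
          _ ≤ _ := (sub_lt_iff_lt_add'.mp h.1).le }
  letI na : NormedAlgebra ℂ (A ⧸ I) :=
    { Submodule.Quotient.normedSpace I ℂ, Ideal.Quotient.algebra ℂ with }
  { nr, sr, na with
    toCompleteSpace := Submodule.Quotient.completeSpace I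
    norm_mul_self_le := by
      rintro ⟨x⟩
      refine le_of_forall_pos_le_add fun ε hε => ?_
      obtain ⟨y, hy, hyn⟩ := Submodule.Quotient.norm_mk_lt
        (Submodule.Quotient.mk (star x * x) : A ⧸ I) (half_pos hε)
      have hk : y - star x * x ∈ I := (Submodule.Quotient.eq I).mp hy
      obtain ⟨e, heI, hes, he1, hek⟩ := exists_almost_unit I hI hstar _ hk (half_pos hε)
      have hx : ‖(Submodule.Quotient.mk x : A ⧸ I)‖ ≤ ‖x * (1 - e)‖ := by
        have : (Submodule.Quotient.mk x : A ⧸ I) = Submodule.Quotient.mk (x * (1 - e)) := by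
          rw [Submodule.Quotient.eq, mul_sub, mul_one, sub_sub_cancel]
          exact I.mul_mem_left _ heI
        rw [this]
        exact Submodule.Quotient.norm_mk_le (S := I) _
      have key : star (x * (1 - e)) * (x * (1 - e)) =
          (1 - e) * y * (1 - e) - (1 - e) * ((y - star x * x) - (y - star x * x) * e) := by
        rw [star_mul, star_sub, star_one, hes]
        noncomm_ring
      have h2 : ‖(1 - e) * y * (1 - e)‖ ≤ ‖y‖ := by
        calc _ ≤ ‖1 - e‖ * ‖y‖ * ‖1 - e‖ := norm_mul₃_le
          _ ≤ 1 * ‖y‖ * 1 := by gcongr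
          _ = ‖y‖ := by ring
      have h3 : ‖(1 - e) * ((y - star x * x) - (y - star x * x) * e)‖ ≤ ε / 2 := by
        calc _ ≤ ‖1 - e‖ * ‖(y - star x * x) - (y - star x * x) * e‖ := norm_mul_le _ _
          _ ≤ 1 * (ε / 2) := by gcongr
          _ = ε / 2 := one_mul _
      calc ‖(Submodule.Quotient.mk x : A ⧸ I)‖ * ‖(Submodule.Quotient.mk x : A ⧸ I)‖
          ≤ ‖x * (1 - e)‖ * ‖x * (1 - e)‖ := by gcongr
        _ = ‖star (x * (1 - e)) * (x * (1 - e))‖ := CStarRing.norm_star_mul_self.symm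
        _ ≤ ‖y‖ + ε / 2 := by
            rw [key]
            exact (norm_sub_le _ _).trans (add_le_add h2 h3)
        _ ≤ ‖(Submodule.Quotient.mk (star x * x) : A ⧸ I)‖ + ε := by linarith
    star_smul := by
      rintro c ⟨a⟩
      exact congrArg (Ideal.Quotient.mk I) (star_smul c a) }

end QuotientCStar

/-! ### The Calkin algebra -/

section Calkin

variable (H : Type*) [NormedAddCommGroup H] [InnerProductSpace ℂ H] [CompleteSpace H]

/-- The ideal of compact operators in `B(H)`. -/
def compactIdeal : Ideal (H →L[ℂ] H) where
  carrier := {f | IsCompactOperator f}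
  add_mem' hf hg := hf.add hg
  zero_mem' := isCompactOperator_zero
  smul_mem' c _ hf := hf.clm_comp c

instance compactIdeal_isTwoSided : (compactIdeal H).IsTwoSided :=
  ⟨fun {_} b ha => IsCompactOperator.comp_clm ha b⟩

instance compactIdeal_isClosed : IsClosed (compactIdeal H : Set (H →L[ℂ] H)) :=
  isClosed_setOfPred_isCompactOperator

theorem compactIdeal_star_mem (T : H →L[ℂ] H) (hT : T ∈ compactIdeal H) :
    star T ∈ compactIdeal H := by
  have hS : IsCompactOperator (T * star T : H →L[ℂ] H) :=
    IsCompactOperator.comp_clm (f := T) hT (star T)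
  have hle : ∀ x y : H, ‖x‖ < 1 → ‖y‖ < 1 →
      dist (star T x) (star T y) ^ 2 ≤
        2 * dist ((T * star T : H →L[ℂ] H) x) ((T * star T : H →L[ℂ] H) y) := by
    intro x y hx hy
    rw [dist_eq_norm, dist_eq_norm, ← map_sub, ← map_sub]
    have h1 : ‖star T (x - y)‖ ^ 2 = RCLike.re ⟪(T * star T : H →L[ℂ] H) (x - y), x - y⟫_ℂ := by
      rw [← inner_self_eq_norm_sq (𝕜 := ℂ), ContinuousLinearMap.star_eq_adjoint,
        ContinuousLinearMap.adjoint_inner_right]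
      rfl
    have h2 : ‖x - y‖ ≤ 2 := (norm_sub_le _ _).trans (by linarith)
    rw [h1]
    calc _ ≤ ‖(T * star T : H →L[ℂ] H) (x - y)‖ * ‖x - y‖ := re_inner_le_norm _ _
      _ ≤ ‖(T * star T : H →L[ℂ] H) (x - y)‖ * 2 := by gcongr
      _ = _ := mul_comm _ _
  change IsCompactOperator (star T : H →L[ℂ] H)
  have hc := (isCompactOperator_iff_isCompact_closure_image_ball
    (T * star T : H →L[ℂ] H).toLinearMap one_pos).mp hS
  refine (isCompactOperator_iff_isCompact_closure_image_ball
    (star T : H →L[ℂ] H).toLinearMap one_pos).mpr ?_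
  have htb := hc.totallyBounded.subset subset_closure
  refine TotallyBounded.isCompact_of_isClosed (TotallyBounded.closure ?_) isClosed_closure
  rw [Metric.totallyBounded_iff]
  intro ε hε
  obtain ⟨t, hts, htf, ht⟩ := htb.exists_subset
    (Metric.dist_mem_uniformity (show 0 < ε ^ 2 / 2 by positivity))
  choose g hg using fun y (hy : y ∈ t) => hts hy
  refine ⟨⋃ y, ⋃ hy : y ∈ t, {star T (g y hy)}, htf.biUnion' fun _ _ => Set.finite_singleton _, ?_⟩
  rintro _ ⟨x, hx, rfl⟩
  obtain ⟨y, hy, hxy⟩ := Set.mem_iUnion₂.mp (ht ⟨x, hx, rfl⟩)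
  refine Set.mem_iUnion₂.mpr ⟨star T (g y hy), Set.mem_iUnion₂.mpr ⟨y, hy, rfl⟩, ?_⟩
  obtain ⟨hgb, hgy⟩ := hg y hy
  have hxy' : dist ((T * star T : H →L[ℂ] H) x) ((T * star T : H →L[ℂ] H) (g y hy)) < ε ^ 2 / 2 := by
    have hgy' : (T * star T : H →L[ℂ] H) (g y hy) = y := hgy
    rw [hgy']
    exact hxy
  have := hle x (g y hy) (by simpa using hx) (by simpa using hgb)
  have h4 : dist (star T x) (star T (g y hy)) ^ 2 < ε ^ 2 := by linarith
  exact lt_of_pow_lt_pow_left₀ 2 hε.le h4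

/-- The Calkin algebra `B(H) / K(H)`. -/
abbrev CalkinAlgebra := (H →L[ℂ] H) ⧸ compactIdeal H

instance CalkinAlgebra.instCStarAlgebra : CStarAlgebra (CalkinAlgebra H) :=
  quotientCStarAlgebra (compactIdeal H) (compactIdeal_star_mem H)

end Calkin

/-! ### Operator spaces -/

/-- The norm of `M_n(A)`, for a C*-algebra `A`: the unique norm making the *-algebra of
matrices a C*-algebra. (The auxiliary order on `A` is the canonical one; it is only used to
access the norm of `CStarMatrix`.) -/
def cstarMatrixNorm {A : Type*} [CStarAlgebra A] {n : ℕ} (x : Matrix (Fin n) (Fin n) A) : ℝ :=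
  letI := CStarAlgebra.spectralOrder A
  letI := CStarAlgebra.spectralOrderedRing A
  ‖CStarMatrix.ofMatrix x‖

/-- An operator space structure on a complex normed space `V`: a family of norms on the matrix
spaces `M_n(V)` that is obtained from a linear isometric embedding of `V` in a C*-algebra. -/
@[ext]
structure OperatorSpaceStructure (V : Type u) [NormedAddCommGroup V] [NormedSpace ℂ V] where
  matNorm : ∀ n : ℕ, Matrix (Fin n) (Fin n) V → ℝ
  exists_embedding : ∃ (A : Type u) (_ : CStarAlgebra A) (σ : V →ₗᵢ[ℂ] A),
    ∀ n (x : Matrix (Fin n) (Fin n) V), matNorm n x = cstarMatrixNorm (x.map σ)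

namespace OperatorSpaceStructure

variable {V : Type u} [NormedAddCommGroup V] [NormedSpace ℂ V]
variable {W : Type v} [NormedAddCommGroup W] [NormedSpace ℂ W]

/-- The operator space structure induced by a linear isometry into a C*-algebra. -/
def ofEmbedding {A : Type u} [CStarAlgebra A] (σ : V →ₗᵢ[ℂ] A) : OperatorSpaceStructure V where
  matNorm _ x := cstarMatrixNorm (x.map σ)
  exists_embedding := ⟨A, inferInstance, σ, fun _ _ => rfl⟩

/-- The completely bounded norm `sup_m ‖u_m : M_m(V) → M_m(W)‖` of a linear map. -/
def cbNorm (S : OperatorSpaceStructure V) (T : OperatorSpaceStructure W) (f : V →ₗ[ℂ] W) : ℝ≥0∞ :=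
  ⨆ (m : ℕ) (x : Matrix (Fin m) (Fin m) V) (_ : S.matNorm m x ≤ 1),
    ENNReal.ofReal (T.matNorm m (x.map f))

end OperatorSpaceStructure

section MatrixAlgebra

open scoped Matrix.Norms.L2Operator

/-- The completely bounded norm of a linear map `V → M_n`, where the `n × n` complex matrices
`M_n` carry the operator space structure of the C*-algebra `M_n` (operator norm on `ℂⁿ`). -/
def OperatorSpaceStructure.cbNormToMatrix {V : Type u} [NormedAddCommGroup V] [NormedSpace ℂ V]
    (S : OperatorSpaceStructure V) (n : ℕ) (f : V →ₗ[ℂ] Matrix (Fin n) (Fin n) ℂ) : ℝ≥0∞ :=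
  S.cbNorm (OperatorSpaceStructure.ofEmbedding
    (LinearIsometry.id : Matrix (Fin n) (Fin n) ℂ →ₗᵢ[ℂ] Matrix (Fin n) (Fin n) ℂ)) f

end MatrixAlgebra

/-- The linear map `V → M_n`, `v ↦ [f_ij(v)]`, corresponding to `[f_ij] ∈ M_n(V*)`. -/
def matrixOfFunctionals {V : Type u} [NormedAddCommGroup V] [NormedSpace ℂ V] {n : ℕ}
    (f : Matrix (Fin n) (Fin n) (StrongDual ℂ V)) : V →ₗ[ℂ] Matrix (Fin n) (Fin n) ℂ where
  toFun v := Matrix.of fun i j => f i j v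
  map_add' v w := by ext i j; simp
  map_smul' c v := by ext i j; simp

/-- The norm on `M_n(V*) ≅ CB(V, M_n)` for the dual `V*` of an operator space. -/
def OperatorSpaceStructure.dualMatNorm {V : Type u} [NormedAddCommGroup V] [NormedSpace ℂ V]
    (S : OperatorSpaceStructure V) (n : ℕ)
    (f : Matrix (Fin n) (Fin n) (StrongDual ℂ V)) : ℝ≥0∞ :=
  S.cbNormToMatrix n (matrixOfFunctionals f)

/-- `V` is linearly isometric to the dual of a Banach space. -/
def HasPredualBanachSpace (V : Type v) [NormedAddCommGroup V] [NormedSpace ℂ V] : Prop :=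
  ∃ (Y : Type u) (_ : NormedAddCommGroup Y) (_ : NormedSpace ℂ Y) (_ : CompleteSpace Y),
    Nonempty (V ≃ₗᵢ[ℂ] StrongDual ℂ Y)

/-- The operator space `(V, S)` is completely isometric to the dual of an operator space,
i.e. it is a dual operator space. -/
def OperatorSpaceStructure.HasPredualOperatorSpace {V : Type v} [NormedAddCommGroup V]
    [NormedSpace ℂ V] (S : OperatorSpaceStructure V) : Prop :=
  ∃ (Y : Type u) (_ : NormedAddCommGroup Y) (_ : NormedSpace ℂ Y) (_ : CompleteSpace Y)
    (T : OperatorSpaceStructure Y) (e : V ≃ₗ[ℂ] StrongDual ℂ Y),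
    ∀ n (x : Matrix (Fin n) (Fin n) V),
      ENNReal.ofReal (S.matNorm n x) = T.dualMatNorm n (x.map e)

/-- A subspace of a unital C*-algebra is an operator system if it is self-adjoint and contains
the unit. -/
def IsOperatorSystem {A : Type*} [CStarAlgebra A] (X : Submodule ℂ A) : Prop :=
  1 ∈ X ∧ ∀ a ∈ X, star a ∈ X

/-- The Hilbert space `ℓ²`. -/
abbrev EllTwo : Type := lp (fun _ : ℕ => ℂ) 2

end

open Filter Topology

/-! ### Norms of matrices over a C*-algebra -/

section MatrixNorm

variable {A : Type*} [CStarAlgebra A]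

/-! The obstruction to an operator space predual is a row that the opposite product turns into a
column. Let `s`, `t` be isometries of `ℓ²` with orthogonal ranges. In `B(ℓ²)` the row `[s t]` has
squared norm `‖ss* + tt*‖ ≤ 1`, while in `Qᵒᵖ` it has squared norm `‖s*s + t*t‖ = 2`. For finite
rank projections `P` tending strongly to the identity, `[Ps Pt]` vanishes in `Q`, so its norm is at
most 1 (`cstarMatrixNorm_row_sq`).

Matrix norms of a dual operator space are lower semicontinuous for pointwise convergence on the
predual (`dualMatNorm_le_of_tendsto`). So a contradiction follows once `Px → x` pointwise on any
predual, which need not be the trace class. By Banach–Alaoglu, `Px` has limit points `y`. As `Pr →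
r` in norm for `r` of finite rank, `‖y + r‖ ≤ ‖x + r‖` for all such `r`, and this forces `y = x`
(`eq_of_norm_add_finiteRank_le`).

The Banach predual is the closed span of the vector functionals. -/

theorem norm_entry_le_cstarMatrixNorm {n : ℕ} (x : Matrix (Fin n) (Fin n) A) (i j : Fin n) :
    ‖x i j‖ ≤ cstarMatrixNorm x :=
  letI := CStarAlgebra.spectralOrder A
  letI := CStarAlgebra.spectralOrderedRing A
  CStarMatrix.norm_entry_le_norm (M := CStarMatrix.ofMatrix x)

theorem continuous_cstarMatrixNorm (n : ℕ) :
    Continuous (cstarMatrixNorm : Matrix (Fin n) (Fin n) A → ℝ) :=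
  letI := CStarAlgebra.spectralOrder A
  letI := CStarAlgebra.spectralOrderedRing A
  continuous_norm.comp (CStarMatrix.ofMatrixL (A := A)).continuous

open WithCStarModule in
-- Such a matrix sends `v` to the vector whose only coordinate is `v i * M i i`, and a vector with
-- one coordinate has the norm of that coordinate.
theorem CStarMatrix.norm_le_of_forall_ne_eq_zero [PartialOrder A] [StarOrderedRing A]
    {n : Type*} [Fintype n] [DecidableEq n] (M : CStarMatrix n n A) (i : n)
    (h : ∀ j k, (j, k) ≠ (i, i) → M j k = 0) : ‖M‖ ≤ ‖M i i‖ := by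
  rw [CStarMatrix.norm_def]
  refine (CStarMatrix.toCLM M).opNorm_le_bound (norm_nonneg _) fun v => ?_
  have : CStarMatrix.toCLM M v = (equiv A (n → A)).symm (Pi.single i (v i * M i i)) := by
    rw [CStarMatrix.toCLM_apply_eq_sum]
    congr 1
    funext k
    rw [Finset.sum_eq_single i (fun j _ hj => by rw [h j k (by simp [hj]), mul_zero]) (by simp)]
    rcases eq_or_ne k i with rfl | hk
    · simp
    · rw [Pi.single_eq_of_ne hk, h i k (by simp [hk]), mul_zero]
  rw [this]
  simp only [norm_single]
  calc _ ≤ ‖v i‖ * ‖M i i‖ := norm_mul_le _ _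
    _ ≤ ‖v‖ * ‖M i i‖ := by gcongr; exact norm_apply_le_norm v i
    _ = _ := mul_comm _ _

theorem cstarMatrixNorm_one_by_one (a : A) :
    cstarMatrixNorm (Matrix.of fun _ _ : Fin 1 => a) = ‖a‖ := by
  refine le_antisymm ?_ (norm_entry_le_cstarMatrixNorm (Matrix.of fun _ _ : Fin 1 => a) 0 0)
  let := CStarAlgebra.spectralOrder A
  let := CStarAlgebra.spectralOrderedRing A
  exact CStarMatrix.norm_le_of_forall_ne_eq_zero _ 0
    fun j k h => absurd (Subsingleton.elim (j, k) (0, 0)) h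

/-- This is the C*-identity for `M * star M`, whose only possibly nonzero entry is the (0, 0) one.
-/
theorem cstarMatrixNorm_row_sq (a b : A) :
    cstarMatrixNorm !![a, b; 0, 0] ^ 2 = ‖a * star a + b * star b‖ := by
  let := CStarAlgebra.spectralOrder A
  let := CStarAlgebra.spectralOrderedRing A
  change ‖CStarMatrix.ofMatrix !![a, b; 0, 0]‖ ^ 2 = _
  set M := CStarMatrix.ofMatrix !![a, b; 0, 0] with hM
  have h00 : (M * star M) 0 0 = a * star a + b * star b := by
    simp [hM, CStarMatrix.mul_apply, CStarMatrix.star_apply]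
  rw [sq, ← CStarRing.norm_self_mul_star, ← h00]
  refine le_antisymm (CStarMatrix.norm_le_of_forall_ne_eq_zero _ 0 ?_)
    CStarMatrix.norm_entry_le_norm
  intro j k hjk
  fin_cases j <;> fin_cases k <;>
    simp_all [CStarMatrix.mul_apply, CStarMatrix.star_apply]

end MatrixNorm

/-! ### Matrix norms of a dual operator space -/

section DualNorm

open scoped Matrix.Norms.L2Operator

variable {V : Type u} [NormedAddCommGroup V] [NormedSpace ℂ V]

theorem OperatorSpaceStructure.matNorm_one (S : OperatorSpaceStructure V) (v : V) :
    S.matNorm 1 (Matrix.of fun _ _ => v) = ‖v‖ := by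
  obtain ⟨A, _, σ, h⟩ := S.exists_embedding
  rw [h, ← σ.norm_map v]
  exact cstarMatrixNorm_one_by_one (σ v)

theorem OperatorSpaceStructure.cstarMatrixNorm_le_dualMatNorm (S : OperatorSpaceStructure V)
    {m n : ℕ} (f : Matrix (Fin n) (Fin n) (StrongDual ℂ V)) {x : Matrix (Fin m) (Fin m) V}
    (hx : S.matNorm m x ≤ 1) :
    ENNReal.ofReal (cstarMatrixNorm (x.map (matrixOfFunctionals f))) ≤ S.dualMatNorm n f :=
  le_iSup₂_of_le (f := fun (m : ℕ) (x : Matrix (Fin m) (Fin m) V) =>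
    ⨆ (_ : S.matNorm m x ≤ 1), ENNReal.ofReal (cstarMatrixNorm (x.map (matrixOfFunctionals f))))
    m x (le_iSup_of_le hx le_rfl)

/-- The matrix norms of a dual operator space are lower semicontinuous for pointwise
convergence. -/
theorem OperatorSpaceStructure.dualMatNorm_le_of_tendsto (S : OperatorSpaceStructure V)
    {ι : Type*} {l : Filter ι} [l.NeBot] {n : ℕ}
    {F : ι → Matrix (Fin n) (Fin n) (StrongDual ℂ V)} {f : Matrix (Fin n) (Fin n) (StrongDual ℂ V)}
    (hF : ∀ i j v, Tendsto (fun k => F k i j v) l (𝓝 (f i j v))) {C : ℝ≥0∞}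
    (hC : ∀ k, S.dualMatNorm n (F k) ≤ C) : S.dualMatNorm n f ≤ C := by
  refine iSup_le fun m => iSup_le fun x => iSup_le fun hx => ?_
  have hlim : Tendsto (fun k => x.map (matrixOfFunctionals (F k))) l
      (𝓝 (x.map (matrixOfFunctionals f))) :=
    tendsto_pi_nhds.mpr fun a => tendsto_pi_nhds.mpr fun b =>
      tendsto_pi_nhds.mpr fun i => tendsto_pi_nhds.mpr fun j => hF i j (x a b)
  refine le_of_tendsto ((ENNReal.continuous_ofReal.comp
    (continuous_cstarMatrixNorm m)).continuousAt.tendsto.comp hlim) (.of_forall fun k => ?_)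
  exact (S.cstarMatrixNorm_le_dualMatNorm (F k) hx).trans (hC k)

theorem OperatorSpaceStructure.norm_le_dualMatNorm_one (S : OperatorSpaceStructure V)
    (f : StrongDual ℂ V) {C : ℝ} (hC : 0 ≤ C)
    (h : S.dualMatNorm 1 (Matrix.of fun _ _ => f) ≤ ENNReal.ofReal C) : ‖f‖ ≤ C := by
  refine f.opNorm_le_of_unit_norm hC fun v hv => ?_
  have hv1 : S.matNorm 1 (Matrix.of fun _ _ => v) ≤ 1 := by rw [S.matNorm_one, hv]
  have h1 := (S.cstarMatrixNorm_le_dualMatNorm (Matrix.of fun _ _ => f) hv1).trans h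
  refine le_trans ?_ ((ENNReal.ofReal_le_ofReal_iff hC).mp h1)
  refine le_trans (le_of_eq ?_) (norm_entry_le_cstarMatrixNorm _ 0 0)
  have : matrixOfFunctionals (Matrix.of fun _ _ : Fin 1 => f) v =
      f v • (1 : Matrix (Fin 1) (Fin 1) ℂ) := by
    ext i j
    simp [matrixOfFunctionals, Subsingleton.elim i j]
  simp only [Matrix.map_apply, Matrix.of_apply]
  rw [this, norm_smul, CStarRing.norm_one, mul_one]

end DualNorm

/-! ### Finite rank perturbations and approximations of operators -/

section Operators

open InnerProductSpace ContinuousLinearMap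

variable {H : Type*} [NormedAddCommGroup H] [InnerProductSpace ℂ H]

variable (H) in
/-- The operators of finite rank, as the span of the operators of rank one. -/
def finiteRankOperators : Submodule ℂ (H →L[ℂ] H) :=
  Submodule.span ℂ (Set.range fun p : H × H => rankOne ℂ p.1 p.2)

theorem rankOne_mem_finiteRankOperators (a b : H) : rankOne ℂ a b ∈ finiteRankOperators H :=
  Submodule.subset_span ⟨(a, b), rfl⟩

/-- Strong convergence becomes norm convergence on rank one operators, since multiplying by `P k` on
the left only moves the vector `a` to `P k a`. -/
theorem tendsto_mul_of_mem_finiteRankOperators {ι : Type*} {l : Filter ι} {P : ι → H →L[ℂ] H}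
    (hP : ∀ x, Tendsto (fun k => P k x) l (𝓝 x)) {r : H →L[ℂ] H}
    (hr : r ∈ finiteRankOperators H) : Tendsto (fun k => P k * r) l (𝓝 r) := by
  induction hr using Submodule.span_induction with
  | mem r hr =>
    obtain ⟨⟨a, b⟩, rfl⟩ := hr
    have h (k) : P k * rankOne ℂ a b = rankOne ℂ (P k a) b := comp_rankOne ..
    simp only [h]
    exact (((rankOne ℂ (E := H) (F := H)).flip b).continuous.tendsto a).comp (hP a)
  | zero => simp [tendsto_const_nhds]
  | add r s _ _ hr hs => simpa only [mul_add] using hr.add hs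
  | smul c r _ hr => simpa only [mul_smul_comm] using hr.const_smul c

/-- `‖p⊥ x p⊥ + c p‖ ≤ max ‖p⊥ x p⊥‖ |c|` for the projection `p` onto a line. -/
theorem norm_add_smul_rankOne_le {ξ : H} (hξ : ‖ξ‖ = 1) {z : H →L[ℂ] H}
    (hz : ∀ v, ⟪ξ, z v⟫_ℂ = 0) (hzξ : z ξ = 0) {M : ℝ} (hM : ‖z‖ ≤ M) {c : ℂ} (hc : ‖c‖ ≤ M) :
    ‖z + c • rankOne ℂ ξ ξ‖ ≤ M := by
  have hM0 : 0 ≤ M := (norm_nonneg _).trans hM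
  refine opNorm_le_bound _ hM0 fun v => ?_
  -- Split `v` along `ξ` and its orthogonal complement. The operator respects this splitting, so
  -- Pythagoras applies on both sides.
  set a := ⟪ξ, v⟫_ℂ with ha
  set w := v - a • ξ with hw
  have hv : v = w + a • ξ := by simp [hw]
  have hξw : ⟪w, ξ⟫_ℂ = 0 := by
    rw [← inner_conj_symm, hw, inner_sub_right, inner_smul_right, inner_self_eq_norm_sq_to_K, hξ]
    simp [ha]
  have e1 : (z + c • rankOne ℂ ξ ξ) v = z w + (c * a) • ξ := by
    have : z v = z w := by rw [hw, map_sub, map_smul, hzξ, smul_zero, sub_zero]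
    simp [this, mul_smul, ← ha]
  have hsq : ‖z w + (c * a) • ξ‖ ^ 2 = ‖z w‖ ^ 2 + (‖c‖ * ‖a‖) ^ 2 := by
    have := norm_add_sq_eq_norm_sq_add_norm_sq_of_inner_eq_zero (𝕜 := ℂ) (z w) ((c * a) • ξ)
      (by rw [inner_smul_right, ← inner_conj_symm, hz]; simp)
    simpa [sq, norm_smul, hξ] using this
  have hvsq : ‖v‖ ^ 2 = ‖w‖ ^ 2 + ‖a‖ ^ 2 := by
    have := norm_add_sq_eq_norm_sq_add_norm_sq_of_inner_eq_zero (𝕜 := ℂ) w (a • ξ)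
      (by rw [inner_smul_right, hξw, mul_zero])
    rw [← hv] at this
    simpa [sq, norm_smul, hξ] using this
  rw [e1]
  refine le_of_sq_le_sq ?_ (by positivity)
  rw [hsq, mul_pow M, hvsq, mul_add]
  have h1 : ‖z w‖ ≤ M * ‖w‖ := (z.le_opNorm w).trans (by gcongr)
  have h2 : ‖c‖ * ‖a‖ ≤ M * ‖a‖ := by gcongr
  rw [← mul_pow, ← mul_pow]
  gcongr

/-- If a diagonal coefficient `c` of `y - x` at a unit vector were nonzero, a finite rank
perturbation could make `x` block diagonal with a corner of modulus `M`, the norm of the other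
block. The norm of `x` then stays at most `M`, but the corner of `y` has modulus `M + ‖c‖`. -/
theorem eq_of_norm_add_finiteRank_le [CompleteSpace H] {x y : H →L[ℂ] H}
    (h : ∀ r ∈ finiteRankOperators H, ‖y + r‖ ≤ ‖x + r‖) : y = x := by
  have key : ∀ ξ : H, ‖ξ‖ = 1 → ⟪ξ, (y - x) ξ⟫_ℂ = 0 := by
    intro ξ hξ
    set p := rankOne ℂ ξ ξ
    have hpv (v : H) : p v = ⟪ξ, v⟫_ℂ • ξ := rfl
    -- With this choice `x + r = (1 - p) * x * (1 - p)`.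
    set r := p * x * p - p * x - x * p with hr
    have hxp : x * p ∈ finiteRankOperators H := by
      have : x * p = rankOne ℂ (x ξ) ξ := comp_rankOne ..
      exact this ▸ rankOne_mem_finiteRankOperators _ _
    have hpT (T : H →L[ℂ] H) : p * T ∈ finiteRankOperators H := by
      have : p * T = rankOne ℂ ξ (adjoint T ξ) := rankOne_comp ..
      exact this ▸ rankOne_mem_finiteRankOperators _ _
    have hrm : r ∈ finiteRankOperators H := by
      refine sub_mem (sub_mem ?_ (hpT x)) hxp
      rw [mul_assoc]; exact hpT _
    have hz (v : H) : ⟪ξ, (x + r) v⟫_ℂ = 0 := by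
      simp [hr, hpv, hξ]
    have hzξ : (x + r) ξ = 0 := by
      simp [hr, hpv, hξ]
    by_contra hne
    set c := ⟪ξ, (y - x) ξ⟫_ℂ with hc
    have hcpos : 0 < ‖c‖ := norm_pos_iff.mpr hne
    set M := ‖x + r‖
    -- The corner `t * c` has modulus exactly `M` and the same phase as `c`, so that it adds to `c`
    -- without cancellation.
    set t : ℝ := M / ‖c‖ with ht
    have ht0 : 0 ≤ t := by positivity
    have hle := h (r + ((t : ℂ) * c) • p) (add_mem hrm
      (Submodule.smul_mem _ _ (rankOne_mem_finiteRankOperators ξ ξ)))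
    rw [← add_assoc, ← add_assoc] at hle
    have hle' := hle.trans (norm_add_smul_rankOne_le hξ hz hzξ le_rfl (c := (t : ℂ) * c) (by
      rw [norm_mul, Complex.norm_real, Real.norm_of_nonneg ht0, ht, div_mul_cancel₀ _ hcpos.ne']))
    have hval : ⟪ξ, (y + r + ((t : ℂ) * c) • p) ξ⟫_ℂ = (1 + t : ℝ) * c := by
      have : y + r + ((t : ℂ) * c) • p = (y - x) + (x + r) + ((t : ℂ) * c) • p := by abel
      rw [this, add_apply, add_apply, inner_add_right, inner_add_right, hz, ← hc]
      simp [hpv, inner_smul_right, hξ]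
      ring
    have hb : ‖(1 + t : ℝ) * c‖ ≤ M := by
      rw [← hval]
      refine (norm_inner_le_norm _ _).trans ?_
      rw [hξ, one_mul]
      exact (le_opNorm _ _).trans (by rw [hξ, mul_one]; exact hle')
    rw [norm_mul, Complex.norm_real, Real.norm_of_nonneg (by positivity), add_mul, one_mul, ht,
      div_mul_cancel₀ _ hcpos.ne'] at hb
    linarith
  rw [← sub_eq_zero]
  -- Over `ℂ`, an operator with zero quadratic form is zero. Rescaling reduces to unit vectors.
  have := (inner_map_self_eq_zero (y - x : H →L[ℂ] H).toLinearMap).mp fun ξ => by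
    rcases eq_or_ne ξ 0 with rfl | hξ
    · simp
    have := key (((‖ξ‖⁻¹ : ℝ) : ℂ) • ξ) (by simp [norm_smul, hξ])
    rw [map_smul, inner_smul_left, inner_smul_right] at this
    have h3 : ⟪ξ, (y - x) ξ⟫_ℂ = 0 := by simpa [hξ, inner_sub_right] using this
    rw [← inner_conj_symm]
    exact (congrArg _ h3).trans (map_zero _)
  ext v
  exact congrArg (fun f : H →ₗ[ℂ] H => f v) this

/-- The projections onto the finite-dimensional subspaces. -/
theorem exists_finiteRank_approximation (H : Type v) [NormedAddCommGroup H]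
    [InnerProductSpace ℂ H] [CompleteSpace H] :
    ∃ (ι : Type v) (l : Filter ι) (P : ι → H →L[ℂ] H), l.NeBot ∧
      (∀ k, ‖P k‖ ≤ 1) ∧ (∀ k, star (P k) = P k) ∧ (∀ k, IsCompactOperator (P k)) ∧
      ∀ x, Tendsto (fun k => P k x) l (𝓝 x) := by
  classical
  let U : Finset H → Submodule ℂ H := fun s => Submodule.span ℂ (s : Set H)
  have : ∀ s, FiniteDimensional ℂ (U s) := fun s => FiniteDimensional.span_finset ℂ s
  refine ⟨Finset H, atTop, fun s => (U s).starProjection, inferInstance, fun s =>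
    (U s).starProjection_norm_le, fun s => ?_, fun s => ?_, fun x => ?_⟩
  · exact isSelfAdjoint_starProjection (U s)
  · exact (isCompactOperator_id.clm_comp (U s).subtypeL).comp_clm (U s).orthogonalProjectionOnto
  · refine Submodule.starProjection_tendsto_self (𝕜 := ℂ) U
      (fun s t hst => Submodule.span_mono (by exact_mod_cast hst)) x ?_
    exact fun y _ => (⨆ s, U s).le_topologicalClosure
      (Submodule.mem_iSup_of_mem {y} (Submodule.subset_span (by simp)))

end Operators

/-! ### The Banach space predual of `B(H)` -/

section Predual

open ContinuousLinearMap InnerProductSpace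

/-- The closed span of a set, as an isometrically embedded Banach space. -/
theorem exists_closedSpan_embedding {E : Type v} [NormedAddCommGroup E] [NormedSpace ℂ E]
    [CompleteSpace E] (s : Set E) :
    ∃ (Y : Type v) (_ : NormedAddCommGroup Y) (_ : NormedSpace ℂ Y) (_ : CompleteSpace Y)
      (j : Y →ₗᵢ[ℂ] E), s ⊆ Set.range j ∧
      ∀ F G : StrongDual ℂ Y, (∀ y, j y ∈ s → F y = G y) → F = G := by
  let p := (Submodule.span ℂ s).topologicalClosure
  have hs (x) (hx : x ∈ s) : x ∈ p :=
    Submodule.le_topologicalClosure _ (Submodule.subset_span hx)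
  have hc : CompleteSpace p := (Submodule.isClosed_topologicalClosure _).completeSpace_coe
  refine ⟨p, inferInstance, inferInstance, hc, p.subtypeₗᵢ, fun x hx => ⟨⟨x, hs x hx⟩, rfl⟩, ?_⟩
  intro F G h
  ext f
  have hle : p ≤ (F - G).ker.map p.subtype := by
    refine Submodule.topologicalClosure_minimal _ (Submodule.span_le.mpr fun x hx => ?_) ?_
    · exact ⟨⟨x, hs x hx⟩, sub_eq_zero.mpr (h _ hx), rfl⟩
    · exact (Submodule.isClosed_topologicalClosure _).isClosedEmbedding_subtypeVal.isClosedMap _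
        (F - G).isClosed_ker
  obtain ⟨g, hg, hgf⟩ := hle f.2
  obtain rfl : g = f := Subtype.ext hgf
  exact sub_eq_zero.mp hg

variable {H : Type v} [NormedAddCommGroup H] [InnerProductSpace ℂ H]

/-- The vector functional `x ↦ ⟪a, x b⟫` on `B(H)`. -/
noncomputable def vectorFunctional (a b : H) : StrongDual ℂ (H →L[ℂ] H) :=
  (innerSL ℂ a) ∘L (apply ℂ H b)

theorem vectorFunctional_apply (a b : H) (x : H →L[ℂ] H) :
    vectorFunctional a b x = ⟪a, x b⟫_ℂ := rfl

theorem norm_vectorFunctional_le (a b : H) : ‖vectorFunctional a b‖ ≤ ‖a‖ * ‖b‖ :=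
  opNorm_le_bound _ (by positivity) fun x => by
    calc ‖⟪a, x b⟫_ℂ‖ ≤ ‖a‖ * ‖x b‖ := norm_inner_le_norm _ _
      _ ≤ ‖a‖ * (‖x‖ * ‖b‖) := by gcongr; exact x.le_opNorm b
      _ = _ := by ring

/-- `B(H)` is the dual of the closed span of the vector functionals. -/
theorem hasPredualBanachSpace_operators [CompleteSpace H] :
    HasPredualBanachSpace.{v} (H →L[ℂ] H) := by
  obtain ⟨Y, _, _, _, j, hj, hext⟩ := exists_closedSpan_embedding
    (Set.range fun p : H × H => vectorFunctional p.1 p.2)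
  choose ω hω using fun a b : H => hj ⟨(a, b), rfl⟩
  replace hω (a b : H) : j (ω a b) = vectorFunctional a b := hω a b
  have hωnorm (a b : H) : ‖ω a b‖ ≤ ‖a‖ * ‖b‖ := by
    rw [← j.norm_map, hω]
    exact norm_vectorFunctional_le a b
  let Φ : (H →L[ℂ] H) →ₗᵢ[ℂ] StrongDual ℂ Y :=
    { toFun := fun x => (apply ℂ ℂ x) ∘L j.toContinuousLinearMap
      map_add' := fun x y => by ext f; simp
      map_smul' := fun c x => by ext f; simp
      norm_map' := fun x => by
        refine le_antisymm (opNorm_le_bound _ (norm_nonneg _) fun f => ?_) ?_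
        · exact ((j f).le_opNorm x).trans_eq (by rw [LinearIsometry.norm_map, mul_comm])
        · refine x.opNorm_le_of_re_inner_le (norm_nonneg _) fun b a hb ha => ?_
          set F := (apply ℂ ℂ x) ∘L j.toContinuousLinearMap
          calc RCLike.re ⟪x b, a⟫_ℂ ≤ ‖⟪x b, a⟫_ℂ‖ := RCLike.re_le_norm _
            _ = ‖⟪a, x b⟫_ℂ‖ := norm_inner_symm _ _
            _ = ‖F (ω a b)‖ := congrArg (fun f => ‖f x‖) (hω a b).symm
            _ ≤ ‖F‖ * (‖a‖ * ‖b‖) := (F.le_opNorm _).trans (by gcongr; exact hωnorm a b)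
            _ = ‖F‖ := by rw [ha, hb]; ring }
  have hΦ (x : H →L[ℂ] H) (a b : H) : Φ x (ω a b) = ⟪a, x b⟫_ℂ := congrArg (fun f => f x) (hω a b)
  refine ⟨Y, inferInstance, inferInstance, inferInstance,
    ⟨LinearIsometryEquiv.ofSurjective Φ fun F => ?_⟩⟩
  have hadd (a a' b : H) : ω (a + a') b = ω a b + ω a' b :=
    j.injective (by ext x; simp [hω, vectorFunctional_apply])
  have hsmul (c : ℂ) (a b : H) : ω (c • a) b = starRingEnd ℂ c • ω a b :=
    j.injective (by ext x; simp [hω, vectorFunctional_apply, mul_comm])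
  have hadd' (a b b' : H) : ω a (b + b') = ω a b + ω a b' :=
    j.injective (by ext x; simp [hω, vectorFunctional_apply])
  have hsmul' (c : ℂ) (a b : H) : ω a (c • b) = c • ω a b :=
    j.injective (by ext x; simp [hω, vectorFunctional_apply])
  -- A functional `F` on the predual is a bounded sesquilinear form in `(a, b)`, hence comes from an
  -- operator by Riesz.
  let B : H →L⋆[ℂ] H →L[ℂ] ℂ := LinearMap.mkContinuous₂
    (LinearMap.mk₂'ₛₗ (starRingEnd ℂ) (RingHom.id ℂ) (fun a b => F (ω a b))
      (fun a a' b => by rw [hadd, map_add]) (fun c a b => by rw [hsmul, map_smul])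
      (fun a b b' => by rw [hadd', map_add]) (fun c a b => by rw [hsmul', map_smul]; rfl))
    ‖F‖ fun a b => by
      rw [mul_assoc]
      exact (F.le_opNorm _).trans (by gcongr; exact hωnorm a b)
  refine ⟨adjoint (continuousLinearMapOfBilin B), hext _ _ ?_⟩
  rintro y ⟨⟨a, b⟩, hab⟩
  obtain rfl : ω a b = y := j.injective ((hω a b).trans hab)
  rw [hΦ, adjoint_inner_right, continuousLinearMapOfBilin_apply]
  rfl

end Predual

/-! ### Isometries of `ℓ²` with orthogonal ranges -/

section Isometries

theorem orthonormal_single_ellTwo :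
    Orthonormal ℂ (fun n : ℕ => (lp.single 2 n (1 : ℂ) : EllTwo)) := by
  rw [orthonormal_iff_ite]
  intro i j
  rw [lp.inner_single_left, lp.single_apply]
  simp [Pi.single_apply]

/-- The two isometries map the standard basis to the vectors of even and of odd index. -/
theorem Orthonormal.exists_linearIsometry_orthogonal_range {E : Type*} [NormedAddCommGroup E]
    [InnerProductSpace ℂ E] [CompleteSpace E] {e : ℕ → E} (he : Orthonormal ℂ e) :
    ∃ s t : EllTwo →ₗᵢ[ℂ] E, ∀ v w, ⟪s v, t w⟫_ℂ = 0 := by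
  have hs := (he.comp (fun n => 2 * n) (fun a b h => by simpa using h)).orthogonalFamily
  have ht := (he.comp (fun n => 2 * n + 1) (fun a b h => by simpa using h)).orthogonalFamily
  refine ⟨hs.linearIsometry, ht.linearIsometry, fun v w => ?_⟩
  have h1 (i : ℕ) : ⟪ht.linearIsometry w, e (2 * i)⟫_ℂ = 0 := by
    rw [← inner_conj_symm, map_eq_zero]
    refine ((ht.hasSum_linearIsometry w).mapL (innerSL ℂ (e (2 * i)))).unique ?_
    convert hasSum_zero with j
    have : 2 * i ≠ 2 * j + 1 := by omega
    simp [he.inner_eq_zero this]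
  rw [← inner_conj_symm, map_eq_zero]
  refine ((hs.hasSum_linearIsometry v).mapL (innerSL ℂ (ht.linearIsometry w))).unique ?_
  convert hasSum_zero with i
  simp [h1]

theorem LinearIsometry.star_mul_self_toContinuousLinearMap {H : Type*} [NormedAddCommGroup H]
    [InnerProductSpace ℂ H] [CompleteSpace H] (s : H →ₗᵢ[ℂ] H) :
    star s.toContinuousLinearMap * s.toContinuousLinearMap = 1 :=
  (ContinuousLinearMap.norm_map_iff_adjoint_comp_self _).mp s.norm_map

theorem LinearIsometry.star_mul_toContinuousLinearMap_eq_zero {H : Type*} [NormedAddCommGroup H]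
    [InnerProductSpace ℂ H] [CompleteSpace H] {s t : H →ₗᵢ[ℂ] H} (h : ∀ v w, ⟪s v, t w⟫_ℂ = 0) :
    star s.toContinuousLinearMap * t.toContinuousLinearMap = 0 := by
  ext w
  refine ext_inner_left ℂ fun v => ?_
  rw [_root_.zero_apply, inner_zero_right, mul_apply_eq_comp,
    ContinuousLinearMap.star_eq_adjoint, ContinuousLinearMap.adjoint_inner_right]
  exact h v w

theorem one_notMem_compactIdeal_ellTwo : (1 : EllTwo →L[ℂ] EllTwo) ∉ compactIdeal EllTwo := by
  intro h
  have : FiniteDimensional ℂ EllTwo := FiniteDimensional.of_isCompactOperator_id h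
  have := orthonormal_single_ellTwo.linearIndependent.finite_of_isNoetherian
  exact not_finite ℕ

end Isometries

/-! ### Absence of an operator space predual -/

section NoPredual

open ContinuousLinearMap

variable {H : Type v} [NormedAddCommGroup H] [InnerProductSpace ℂ H] [CompleteSpace H]

variable (H) in
/-- The isometry `x ↦ (x, ẋ)` from `B(H)` to `B(H) ⊕ Q(H)ᵒᵖ`. -/
noncomputable def calkinOpEmbedding :
    (H →L[ℂ] H) →ₗᵢ[ℂ] (H →L[ℂ] H) × (CalkinAlgebra H)ᵐᵒᵖ where
  toFun x := (x, MulOpposite.op (Ideal.Quotient.mk (compactIdeal H) x))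
  map_add' x y := by simp
  map_smul' c x := rfl
  norm_map' x := max_eq_left (Submodule.Quotient.norm_mk_le (S := compactIdeal H) x)

theorem isOperatorSystem_range_calkinOpEmbedding :
    IsOperatorSystem (LinearMap.range (calkinOpEmbedding H).toLinearMap) := by
  refine ⟨⟨1, rfl⟩, ?_⟩
  rintro _ ⟨x, rfl⟩
  exact ⟨star x, rfl⟩

/-- For a dual operator space structure on `B(H)`, finite rank compressions converge pointwise on
the predual. -/
theorem tendsto_of_isometry_dualMatNorm {Y : Type u} [NormedAddCommGroup Y] [NormedSpace ℂ Y]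
    (T : OperatorSpaceStructure Y) (e : (H →L[ℂ] H) ≃ₗ[ℂ] StrongDual ℂ Y)
    (he : ∀ x, T.dualMatNorm 1 (Matrix.of fun _ _ => e x) = ENNReal.ofReal ‖x‖)
    {ι : Type*} {l : Filter ι} {P : ι → H →L[ℂ] H} (hP1 : ∀ k, ‖P k‖ ≤ 1)
    (hP : ∀ x, Tendsto (fun k => P k x) l (𝓝 x)) (x : H →L[ℂ] H) (v : Y) :
    Tendsto (fun k => e (P k * x) v) l (𝓝 (e x v)) := by
  have hle (x) : ‖e x‖ ≤ ‖x‖ := T.norm_le_dualMatNorm_one (e x) (norm_nonneg _) (he x).le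
  have hPx (k) (x : H →L[ℂ] H) : ‖P k * x‖ ≤ ‖x‖ :=
    (norm_mul_le _ _).trans (mul_le_of_le_one_left (norm_nonneg _) (hP1 k))
  -- Along an ultrafilter the bounded family `e (P k * x)` has a weak* limit `e y`. It remains to
  -- show `y = x`.
  rw [tendsto_iff_ultrafilter]
  intro U hU
  obtain ⟨g, -, hg⟩ := (WeakDual.isCompact_closedBall (𝕜 := ℂ) (E := Y) 0 ‖x‖).ultrafilter_le_nhds
    (U.map fun k => StrongDual.toWeakDual (e (P k * x))) (by
      rw [le_principal_iff]
      refine Eventually.of_forall (f := (U : Filter ι)) fun k => ?_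
      exact mem_closedBall_zero_iff.mpr ((hle _).trans (hPx k x)))
  have hg' (w : Y) : Tendsto (fun k => e (P k * x) w) U (𝓝 (g w)) :=
    ((WeakDual.eval_continuous w).tendsto g).comp hg
  obtain ⟨y, hy⟩ := e.surjective (WeakDual.toStrongDual g)
  have hyg (w : Y) : e y w = g w := by rw [hy]; rfl
  suffices y = x by
    rw [← this, hyg, this]
    exact hg' v
  refine eq_of_norm_add_finiteRank_le fun r hr => ?_
  have hr' (w : Y) : Tendsto (fun k => e (P k * r) w) U (𝓝 (e r w)) := by
    have h1 := (tendsto_mul_of_mem_finiteRankOperators hP hr).mono_left hU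
    have h2 : Continuous e :=
      AddMonoidHomClass.continuous_of_bound e 1 fun x => by simpa using hle x
    exact ((ContinuousLinearMap.apply ℂ ℂ w).continuous.tendsto _).comp ((h2.tendsto r).comp h1)
  -- `e (y + r)` is the pointwise limit of `e (P k * (x + r))`, so semicontinuity bounds its norm.
  have h3 : T.dualMatNorm 1 (Matrix.of fun _ _ => e (y + r)) ≤ ENNReal.ofReal ‖x + r‖ := by
    refine T.dualMatNorm_le_of_tendsto (l := (U : Filter ι))
      (F := fun k => Matrix.of fun _ _ => e (P k * (x + r))) (fun i j w => ?_) fun k => ?_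
    · simp only [Matrix.of_apply, mul_add, map_add, _root_.add_apply, hyg]
      exact (hg' w).add (hr' w)
    · rw [he]
      exact ENNReal.ofReal_le_ofReal (hPx k _)
  rw [he] at h3
  exact (ENNReal.ofReal_le_ofReal_iff (norm_nonneg _)).mp h3

/-- The sum is the projection onto the span of the two orthogonal ranges. -/
theorem norm_mul_star_add_mul_star_le_one {s t : H →L[ℂ] H} (hs : star s * s = 1)
    (ht : star t * t = 1) (hst : star s * t = 0) : ‖s * star s + t * star t‖ ≤ 1 := by
  have hts : star t * s = 0 := by simpa using congrArg star hst
  have h : IsStarProjection (s * star s + t * star t) := by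
    refine ⟨?_, by simp [IsSelfAdjoint]⟩
    have h1 : s * star s * (s * star s) = s * star s := by
      rw [mul_assoc, ← mul_assoc (star s), hs, one_mul]
    have h2 : t * star t * (t * star t) = t * star t := by
      rw [mul_assoc, ← mul_assoc (star t), ht, one_mul]
    have h3 : s * star s * (t * star t) = 0 := by
      rw [mul_assoc, ← mul_assoc (star s), hst, zero_mul, mul_zero]
    have h4 : t * star t * (s * star s) = 0 := by
      rw [mul_assoc, ← mul_assoc (star t), hts, zero_mul, mul_zero]
    rw [IsIdempotentElem, mul_add, add_mul, add_mul, h1, h2, h3, h4, add_zero, zero_add]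
  exact h.norm_le

theorem not_hasPredualOperatorSpace_calkinOpEmbedding {s t : H →L[ℂ] H} (hs : star s * s = 1)
    (ht : star t * t = 1) (hst : star s * t = 0) (hH : (1 : H →L[ℂ] H) ∉ compactIdeal H) :
    ¬ OperatorSpaceStructure.HasPredualOperatorSpace.{u, v}
      (OperatorSpaceStructure.ofEmbedding (calkinOpEmbedding H)) := by
  rintro ⟨Y, _, _, _, T, e, he⟩
  have he1 (x) : T.dualMatNorm 1 (Matrix.of fun _ _ => e x) = ENNReal.ofReal ‖x‖ := by
    rw [← OperatorSpaceStructure.matNorm_one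
      (OperatorSpaceStructure.ofEmbedding (calkinOpEmbedding H)) x, he]
    rfl
  obtain ⟨ι, l, P, _, hP1, hPstar, hPc, hP⟩ := exists_finiteRank_approximation H
  set φ := calkinOpEmbedding H
  have hrow (a b : H →L[ℂ] H) : (!![a, b; 0, 0] : Matrix (Fin 2) (Fin 2) _).map φ =
      !![φ a, φ b; 0, 0] := by
    ext i j <;> fin_cases i <;> fin_cases j <;> simp
  have hcomp (k) : (OperatorSpaceStructure.ofEmbedding φ).matNorm 2
      !![P k * s, P k * t; 0, 0] ≤ 1 := by
    change cstarMatrixNorm _ ≤ 1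
    rw [hrow]
    refine le_of_sq_le_sq ?_ zero_le_one
    rw [cstarMatrixNorm_row_sq]
    -- Compactness of `P k` kills the Calkin component, leaving only the harmless row norm in
    -- `B(H)`.
    have hφP (x : H →L[ℂ] H) : φ (P k * x) = (P k * x, 0) :=
      Prod.ext rfl (congrArg MulOpposite.op (Ideal.Quotient.eq_zero_iff_mem.mpr
        ((compactIdeal H).mul_mem_right x (hPc k))))
    have : φ (P k * s) * star (φ (P k * s)) + φ (P k * t) * star (φ (P k * t)) =
        (P k * (s * star s + t * star t) * P k, 0) := by
      rw [hφP, hφP]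
      refine Prod.ext ?_ (by simp)
      change P k * s * star (P k * s) + P k * t * star (P k * t) = _
      rw [star_mul, star_mul, hPstar]
      noncomm_ring
    rw [this, Prod.norm_mk, norm_zero, max_eq_left (norm_nonneg _), one_pow]
    calc _ ≤ ‖P k‖ * ‖s * star s + t * star t‖ * ‖P k‖ := norm_mul₃_le
      _ ≤ 1 * 1 * 1 := by
        gcongr
        exacts [hP1 k, norm_mul_star_add_mul_star_le_one hs ht hst, hP1 k]
      _ = 1 := by norm_num
  have hlim : T.dualMatNorm 2 ((!![s, t; 0, 0] : Matrix (Fin 2) (Fin 2) _).map e) ≤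
      ENNReal.ofReal 1 := by
    refine T.dualMatNorm_le_of_tendsto (l := l)
      (F := fun k => (!![P k * s, P k * t; 0, 0] : Matrix (Fin 2) (Fin 2) _).map e)
      (fun i j w => ?_) fun k => ?_
    · have h (x) := tendsto_of_isometry_dualMatNorm T e he1 hP1 hP x w
      fin_cases i <;> fin_cases j
      exacts [h s, h t, tendsto_const_nhds, tendsto_const_nhds]
    · rw [← he]
      exact ENNReal.ofReal_le_ofReal (hcomp k)
  rw [← he, ENNReal.ofReal_le_ofReal_iff zero_le_one] at hlim
  have hsq : cstarMatrixNorm !![φ s, φ t; 0, 0] ^ 2 ≤ 1 := by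
    rw [← hrow]
    exact pow_le_one₀ ((norm_nonneg _).trans (norm_entry_le_cstarMatrixNorm
      ((!![s, t; 0, 0] : Matrix (Fin 2) (Fin 2) _).map φ) 0 0)) hlim
  rw [cstarMatrixNorm_row_sq] at hsq
  -- In the opposite algebra `x * star x` is the class of `star x * x`, so each isometry contributes
  -- 1.
  have hsnd : (φ s * star (φ s) + φ t * star (φ t)).2 = 2 := by
    have h (x : H →L[ℂ] H) (hx : star x * x = 1) : (φ x * star (φ x)).2 = 1 := by
      change MulOpposite.op (Ideal.Quotient.mk (compactIdeal H) (star x * x)) = 1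
      rw [hx]
      rfl
    rw [Prod.snd_add, h s hs, h t ht, one_add_one_eq_two]
  -- Noncompactness of the identity gives `‖1‖ = 1` in the Calkin algebra, hence `‖2‖ = 2`.
  have hnt : Nontrivial (CalkinAlgebra H) :=
    ⟨1, 0, fun h => hH (Ideal.Quotient.eq_zero_iff_mem.mp h)⟩
  have h2 : ‖(2 : (CalkinAlgebra H)ᵐᵒᵖ)‖ = 2 := by
    have : (2 : (CalkinAlgebra H)ᵐᵒᵖ) = (2 : ℂ) • 1 := by
      rw [two_smul, one_add_one_eq_two]
    rw [this, norm_smul, CStarRing.norm_one, mul_one, Complex.norm_ofNat]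
  have := (_root_.norm_snd_le _).trans hsq
  rw [hsnd, h2] at this
  norm_num at this

end NoPredual

theorem mainTheorem10 :
    ∃ (S : OperatorSpaceStructure.{0} (EllTwo →L[ℂ] EllTwo))
      (φ : (EllTwo →L[ℂ] EllTwo) →ₗᵢ[ℂ]
        (EllTwo →L[ℂ] EllTwo) × (CalkinAlgebra EllTwo)ᵐᵒᵖ),
      (∀ x, φ x = (x, MulOpposite.op (Ideal.Quotient.mk (compactIdeal EllTwo) x))) ∧
      IsOperatorSystem (LinearMap.range φ.toLinearMap) ∧
      S = OperatorSpaceStructure.ofEmbedding φ ∧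
      HasPredualBanachSpace.{0} (EllTwo →L[ℂ] EllTwo) ∧
      ¬ OperatorSpaceStructure.HasPredualOperatorSpace.{u, 0} S := by
  obtain ⟨s, t, hst⟩ := orthonormal_single_ellTwo.exists_linearIsometry_orthogonal_range
  exact ⟨_, calkinOpEmbedding EllTwo, fun _ => rfl, isOperatorSystem_range_calkinOpEmbedding, rfl,
    hasPredualBanachSpace_operators,
    not_hasPredualOperatorSpace_calkinOpEmbedding s.star_mul_self_toContinuousLinearMap
      t.star_mul_self_toContinuousLinearMap
      (LinearIsometry.star_mul_toContinuousLinearMap_eq_zero hst) one_notMem_compactIdeal_ellTwo⟩
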